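/- Let $q$ be an indeterminate. Write $(q;q)_n=\prod_{i=1}^{n}(1-q^i)$, and for integers $a,m$ let ${a\brack m}_q=\frac{(q;q)_a}{(q;q)_m(q;q)_{a-m}}$ if $a\ge m\ge 0$ and ${a\brack m}_q=0$ otherwise. For $m,n_1,n_2\ge 0$ let \[A(n_1,n_2,m)=\frac{(2m+n_1+n_2+1)(2m+n_1+n_2)}{2}+m(n_1+n_2)+(n_1+n_2)^2-n_1 ,\] and for integers $m,b,a$ let $\binom{m;b;q}{a}_2=\sum_{k\ge0}q^{k(k+b)}{m\brack k}_q{m-k\brack k+a}_q$. For an integer $N\ge 1$, with $\mathcal N=N-m-n_1-n_2$, put \[L_N(q)=\sum_{m,n_1,n_2\ge0}q^{A(n_1,n_2,m)}{3\mathcal N\brack m}_q{\mathcal N+\lfloor n_1/2\rfloor\brack\lfloor n_1/2\rfloor}_{q^6}{\mathcal N+\lfloor n_2/2\rfloor\brack\lfloor n_2/2\rfloor}_{q^6},\qquad R_N(q)=\sum_{j=-N}^{N}q^{j(3j-1)/2}\binom{N;j;q^3}{j}_2 .\] Say that a partition satisfies Schur's gap conditions if any two of its parts differ by at least $3$, and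 by at least $6$ if both are multiples of $3$. Then the following hold. (1) For every $N\ge1$, $L_N(q)$ is the generating function for the number of partitions that satisfy Schur's gap conditions and have all parts $\le 3N-1$. (2) For every $N\ge1$, $R_N(q)$ is the same generating function; in particular the polynomial identity $L_N(q)=R_N(q)$ holds. (3) As $N\to\infty$, coefficient by coefficient, $L_N(q)$ converges to the generating function for the number of partitions satisfying Schur's gap conditions, and $R_N(q)$ converges to the generating function for the number of partitions into distinct parts congruent to $\pm1$ modulo $3$. (4) Consequently Schur's theorem holds: for every $n\ge0$, the number of partitions of $n$ into distinct parts congruent to $\pm1$ modulo $3$ equals the number of partitions of $n$ satisfying Schur's gap conditions. -/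

import Mathlib

namespace SchurIdentity

/-- The finite `q`-Pochhammer symbol `(a;q)_n = (1-a)(1-aq)⋯(1-aq^(n-1))`. -/
def qPoch {K : Type*} [Field K] (a q : K) (n : ℕ) : K :=
  ∏ i ∈ Finset.range n, (1 - a * q ^ i)

/-- The `q`-binomial coefficient `[a over m]_q = (q;q)_a / ((q;q)_m (q;q)_(a-m))` for integers
`a ≥ m ≥ 0`, and `0` for all other pairs of integers. -/
def qBinom {K : Type*} [Field K] (q : K) (a m : ℤ) : K :=
  if 0 ≤ m ∧ m ≤ a then
    qPoch q q a.toNat / (qPoch q q m.toNat * qPoch q q (a - m).toNat)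
  else 0

/-- The round `q`-trinomial coefficient
`(m; b; q over a)_2 = ∑_{k ≥ 0} q^(k(k+b)) [m over k]_q [m-k over k+a]_q`.
Only finitely many terms are nonzero, see `finite_support_qTrinom`. -/
noncomputable def qTrinom {K : Type*} [Field K] (q : K) (m b a : ℤ) : K :=
  ∑ᶠ k : ℕ, q ^ ((k : ℤ) * (k + b)) * qBinom q m k * qBinom q (m - k) (k + a)

/-- The exponent `A(n₁,n₂,m)`; the division by two is exact. -/
def expA (n₁ n₂ m : ℕ) : ℤ :=
  ((2 * m + n₁ + n₂ + 1) * (2 * m + n₁ + n₂) / 2 : ℤ) + m * (n₁ + n₂) + ((n₁ : ℤ) + n₂) ^ 2 - n₁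

/-- The summand of the left-hand side, with `N - m - n₁ - n₂` in the role of the script `N`. -/
def lhsTerm {K : Type*} [Field K] (q : K) (N : ℤ) (m n₁ n₂ : ℕ) : K :=
  q ^ expA n₁ n₂ m
    * qBinom q (3 * (N - m - n₁ - n₂)) m
    * qBinom (q ^ 6) ((N - m - n₁ - n₂) + (n₁ / 2 : ℕ)) (n₁ / 2 : ℕ)
    * qBinom (q ^ 6) ((N - m - n₁ - n₂) + (n₂ / 2 : ℕ)) (n₂ / 2 : ℕ)

/-- The left-hand side: the sum over all `m, n₁, n₂ ≥ 0`.
Only finitely many terms are nonzero, see `finite_support_lhsTerm`. -/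
noncomputable def lhs {K : Type*} [Field K] (q : K) (N : ℤ) : K :=
  ∑ᶠ t : ℕ × ℕ × ℕ, lhsTerm q N t.1 t.2.1 t.2.2

/-- The right-hand side `∑_{j=-N}^{N} q^(j(3j-1)/2) (N; j; q³ over j)_2`; the division by two
is exact. -/
noncomputable def rhs {K : Type*} [Field K] (q : K) (N : ℤ) : K :=
  ∑ j ∈ Finset.Icc (-N) N, q ^ (j * (3 * j - 1) / 2 : ℤ) * qTrinom (q ^ 3) N j j

theorem finite_support_qTrinom {K : Type*} [Field K] (q : K) (m b a : ℤ) :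
    (Function.support fun k : ℕ =>
      q ^ ((k : ℤ) * (k + b)) * qBinom q m k * qBinom q (m - k) (k + a)).Finite := by
  refine (Finset.range (m.toNat + 1)).finite_toSet.subset fun k hk => ?_
  by_contra h
  refine hk ?_
  have h0 : qBinom q m k = 0 := by
    refine if_neg fun hc => h ?_
    simp only [Finset.coe_range, Set.mem_Iio]
    omega
  simp [h0]

theorem lhsTerm_eq_zero {K : Type*} [Field K] (q : K) (N : ℤ) (m n₁ n₂ : ℕ)
    (h : N < m + n₁ + n₂) : lhsTerm q N m n₁ n₂ = 0 := by
  have h0 : qBinom q (3 * (N - m - n₁ - n₂)) m = 0 := if_neg fun hc => by omega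
  simp [lhsTerm, h0]

theorem finite_support_lhsTerm {K : Type*} [Field K] (q : K) (N : ℤ) :
    (Function.support fun t : ℕ × ℕ × ℕ => lhsTerm q N t.1 t.2.1 t.2.2).Finite := by
  refine (Finset.range (N.toNat + 1) ×ˢ (Finset.range (N.toNat + 1) ×ˢ
    Finset.range (N.toNat + 1))).finite_toSet.subset fun t ht => ?_
  by_contra h
  refine ht (lhsTerm_eq_zero q N t.1 t.2.1 t.2.2 ?_)
  by_contra hc
  refine h ?_
  simp only [Finset.coe_product, Finset.coe_range, Set.mem_prod, Set.mem_Iio]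
  omega

/-- The gap conditions of Schur's theorem: the gap between any two parts is at least `3`, and at
least `6` if both parts are multiples of `3` (in particular no part is repeated). -/
def IsSchurGap {n : ℕ} (p : Nat.Partition n) : Prop :=
  p.parts.Nodup ∧
    ∀ a ∈ p.parts, ∀ b ∈ p.parts, a < b → a + 3 ≤ b ∧ (3 ∣ a → 3 ∣ b → a + 6 ≤ b)

/-- The number of partitions of `n` satisfying the gap conditions. -/
noncomputable def gapCount (n : ℕ) : ℕ :=
  Nat.card {p : Nat.Partition n // IsSchurGap p}

/-- The number of partitions of `n` satisfying the gap conditions with every part at most `M`. -/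
noncomputable def gapCountLE (M n : ℕ) : ℕ :=
  Nat.card {p : Nat.Partition n // IsSchurGap p ∧ ∀ a ∈ p.parts, a ≤ M}

/-- The number of partitions of `n` into distinct parts congruent to `±1` modulo `3`. -/
noncomputable def distinctCount (n : ℕ) : ℕ :=
  Nat.card {p : Nat.Partition n //
    p.parts.Nodup ∧ ∀ a ∈ p.parts, (a : ℤ) ≡ 1 [ZMOD 3] ∨ (a : ℤ) ≡ -1 [ZMOD 3]}

/-- The generating function `∑_{n ≥ 0} c(n) qⁿ`, as a formal power series inside the field of
formal Laurent series over `ℚ`. -/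
noncomputable def genSeries (c : ℕ → ℕ) : LaurentSeries ℚ :=
  ((PowerSeries.mk fun n => (c n : ℚ) : PowerSeries ℚ) : LaurentSeries ℚ)

/-- The indeterminate `q` of the field of formal Laurent series over `ℚ`. -/
noncomputable def qVar : LaurentSeries ℚ := ((PowerSeries.X : PowerSeries ℚ) : LaurentSeries ℚ)

end SchurIdentity

/-! Three sequences are shown to coincide: the two sides `lhs` and `rhs`, and the generating
polynomials of Schur gap sets with parts at most `3N - 1`. Each takes the values `1` and `1 + q +
q²` at `N = 0, 1` and satisfies `f (N+2) = (1 + (q + q²) q^(3(N+1))) f (N+1) + q^(3(N+1)) (1 -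
q^(3(N+1))) f N`, so `eq_of_recurrence` identifies them.

For gap sets the recurrence comes from removing the largest part (`sumGen_gapSets_add_two`). For
`lhs`, the exponent separates once `M = m + n₁ + n₂` is fixed, and the inner sum is the
`X^M`-coefficient of a product that telescopes to a simple rational function (`genInner_succ`); its
functional equation gives a recurrence on each level `M`, and these are summed
(`sum_lhsLevel_add_two`). For `rhs`, the `q`-binomial theorem collapses the trinomial sum to a
single sum `binomSum` (`rhs_eq_binomSum`), whose recurrence follows from the two `q`-Pascal rules
(`binomSum_add_two`).

Up to an error divisible by `q^N`, `binomSum` is a finite product generating distinct parts prime to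
`3` (`binomSum_sub_mem`). Comparing the coefficient of `q^n` for large `N` gives both limits and
Schur's theorem. -/

namespace SchurIdentity

/-! ### Gaussian binomials: Pascal rules and the `q`-binomial theorem. -/

section QBinomial

variable {K : Type*} [Field K] {q : K}

/-- The `q`-binomial coefficient with natural number arguments. -/
def gauss (q : K) (n k : ℕ) : K := qBinom q n k

theorem qPoch_succ (a q : K) (n : ℕ) :
    qPoch a q (n + 1) = qPoch a q n * (1 - a * q ^ n) :=
  Finset.prod_range_succ _ _

theorem qPoch_self_ne_zero (hq : ∀ n : ℕ, q ^ (n + 1) ≠ 1) (n : ℕ) : qPoch q q n ≠ 0 := by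
  refine Finset.prod_ne_zero_iff.2 fun i _ => ?_
  rw [← pow_succ']
  exact sub_ne_zero.2 (hq i).symm

theorem gauss_add (q : K) (m k : ℕ) :
    gauss q (m + k) k = qPoch q q (m + k) / (qPoch q q k * qPoch q q m) := by
  have h : ((m + k : ℕ) : ℤ) - (k : ℤ) = (m : ℕ) := by push_cast; ring
  rw [gauss, qBinom, if_pos ⟨by positivity, by push_cast; omega⟩, h]
  simp only [Int.toNat_natCast]

theorem gauss_of_lt {n k : ℕ} (h : n < k) : gauss q n k = 0 :=
  if_neg fun hc => by omega

theorem gauss_self (hq : ∀ n : ℕ, q ^ (n + 1) ≠ 1) (n : ℕ) : gauss q n n = 1 := by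
  have h := gauss_add q 0 n
  have h0 : qPoch q q 0 = 1 := by simp [qPoch]
  rwa [zero_add, h0, mul_one, div_self (qPoch_self_ne_zero hq n)] at h

theorem gauss_zero_right (hq : ∀ n : ℕ, q ^ (n + 1) ≠ 1) (n : ℕ) : gauss q n 0 = 1 := by
  have h := gauss_add q n 0
  have h0 : qPoch q q 0 = 1 := by simp [qPoch]
  rwa [add_zero, h0, one_mul, div_self (qPoch_self_ne_zero hq n)] at h

/-- The first `q`-Pascal rule. -/
theorem gauss_succ_succ (hq : ∀ n : ℕ, q ^ (n + 1) ≠ 1) (n k : ℕ) :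
    gauss q (n + 1) (k + 1) = gauss q n (k + 1) + q ^ (n - k) * gauss q n k := by
  rcases lt_trichotomy n k with h | rfl | h
  · simp [gauss_of_lt h, gauss_of_lt (Nat.lt_succ_of_lt h), gauss_of_lt (Nat.succ_lt_succ h)]
  · simp [gauss_self hq, gauss_of_lt (Nat.lt_succ_self n)]
  · obtain ⟨m, rfl⟩ := Nat.exists_eq_add_of_lt h
    have e1 := gauss_add q (m + 1) (k + 1)
    have e2 := gauss_add q m (k + 1)
    have e3 := gauss_add q (m + 1) k
    rw [show k + m + 1 + 1 = m + 1 + (k + 1) by ring, e1,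
      show k + m + 1 = m + (k + 1) by ring, e2, show m + (k + 1) = m + 1 + k by ring, e3,
      show m + 1 + (k + 1) = m + 1 + k + 1 by ring, show m + 1 + k - k = m + 1 by omega]
    have a1 := qPoch_self_ne_zero hq k
    have a2 := qPoch_self_ne_zero hq m
    have a3 := qPoch_self_ne_zero hq (k + 1)
    have a4 := qPoch_self_ne_zero hq (m + 1)
    rw [qPoch_succ q q (m + 1 + k)]
    rw [qPoch_succ] at a3 a4 ⊢
    rw [qPoch_succ q q m]
    have b1 := right_ne_zero_of_mul a3
    have b2 := right_ne_zero_of_mul a4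
    field_simp
    ring

/-- The second `q`-Pascal rule. -/
theorem gauss_succ_succ' (hq : ∀ n : ℕ, q ^ (n + 1) ≠ 1) (n k : ℕ) :
    gauss q (n + 1) (k + 1) = gauss q n k + q ^ (k + 1) * gauss q n (k + 1) := by
  rcases lt_trichotomy n k with h | rfl | h
  · simp [gauss_of_lt h, gauss_of_lt (Nat.lt_succ_of_lt h), gauss_of_lt (Nat.succ_lt_succ h)]
  · simp [gauss_self hq, gauss_of_lt (Nat.lt_succ_self n)]
  · obtain ⟨m, rfl⟩ := Nat.exists_eq_add_of_lt h
    have e1 := gauss_add q (m + 1) (k + 1)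
    have e2 := gauss_add q m (k + 1)
    have e3 := gauss_add q (m + 1) k
    rw [show k + m + 1 + 1 = m + 1 + (k + 1) by ring, e1,
      show k + m + 1 = m + (k + 1) by ring, e2, show m + (k + 1) = m + 1 + k by ring, e3,
      show m + 1 + (k + 1) = m + 1 + k + 1 by ring]
    have a1 := qPoch_self_ne_zero hq k
    have a2 := qPoch_self_ne_zero hq m
    have a3 := qPoch_self_ne_zero hq (k + 1)
    have a4 := qPoch_self_ne_zero hq (m + 1)
    rw [qPoch_succ q q (m + 1 + k)]
    rw [qPoch_succ] at a3 a4 ⊢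
    rw [qPoch_succ q q m]
    have b1 := right_ne_zero_of_mul a3
    have b2 := right_ne_zero_of_mul a4
    field_simp
    ring

theorem pow_pow_succ_ne_one (hq : ∀ n : ℕ, q ^ (n + 1) ≠ 1) (k n : ℕ) :
    (q ^ (k + 1)) ^ (n + 1) ≠ 1 := by
  rw [← pow_mul, show (k + 1) * (n + 1) = (k + 1) * n + k + 1 by ring]
  exact hq _

theorem choose_succ_two (a : ℕ) : (a + 1).choose 2 = a + a.choose 2 := by
  simp [Nat.choose_succ_succ' a 1]

theorem two_mul_choose_two (a : ℕ) : 2 * (a.choose 2 : ℤ) = a * (a - 1) := by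
  induction a with
  | zero => simp
  | succ a ih => rw [choose_succ_two]; push_cast; linear_combination ih

/-- The weight `q^(a choose 2)` absorbs the factor `q^(n-a)` of the first Pascal rule into `q^n`,
which is independent of `a` and can leave a sum over `a`. -/
theorem pow_choose_mul_gauss_succ (hq : ∀ n : ℕ, q ^ (n + 1) ≠ 1) (n a : ℕ) :
    q ^ (a + 1).choose 2 * gauss q (n + 1) (a + 1) =
      q ^ (a + 1).choose 2 * gauss q n (a + 1) + q ^ n * (q ^ a.choose 2 * gauss q n a) := by
  rcases lt_or_ge n a with h | h
  · simp [gauss_of_lt h, gauss_of_lt (Nat.lt_succ_of_lt h), gauss_of_lt (Nat.succ_lt_succ h)]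
  · rw [gauss_succ_succ hq, mul_add, choose_succ_two, ← mul_assoc, ← pow_add, ← mul_assoc,
      ← pow_add]
    congr 3
    omega

theorem pow_choose_mul_gauss_succ' (hq : ∀ n : ℕ, q ^ (n + 1) ≠ 1) (n a : ℕ) :
    q ^ (a + 1).choose 2 * gauss q (n + 1) (a + 1) =
      q ^ (a + 1) * (q ^ (a + 1).choose 2 * gauss q n (a + 1)) +
        q ^ a * (q ^ a.choose 2 * gauss q n a) := by
  rw [gauss_succ_succ' hq, choose_succ_two]
  ring

/-- The `q`-binomial theorem. -/
theorem prod_one_add_mul_pow (hq : ∀ n : ℕ, q ^ (n + 1) ≠ 1) (y : K) (n : ℕ) :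
    ∏ i ∈ Finset.range n, (1 + y * q ^ i) =
      ∑ a ∈ Finset.range (n + 1), q ^ a.choose 2 * gauss q n a * y ^ a := by
  induction n with
  | zero => simp [gauss_zero_right hq]
  | succ n ih =>
    rw [Finset.prod_range_succ, ih, Finset.sum_range_succ' _ (n + 1)]
    simp only [pow_choose_mul_gauss_succ hq, add_mul, Finset.sum_add_distrib]
    rw [Finset.sum_range_succ (fun a => q ^ (a + 1).choose 2 * gauss q n (a + 1) * y ^ (a + 1)),
      gauss_of_lt (Nat.lt_succ_self n), mul_add, mul_one, gauss_zero_right hq, Finset.sum_mul]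
    have h (a : ℕ) : q ^ n * (q ^ a.choose 2 * gauss q n a) * y ^ (a + 1) =
      q ^ a.choose 2 * gauss q n a * y ^ a * (y * q ^ n) := by ring
    simp only [h]
    rw [Finset.sum_range_succ' (fun a => q ^ a.choose 2 * gauss q n a * y ^ a),
      gauss_zero_right hq]
    ring

end QBinomial

end SchurIdentity

namespace SchurIdentity

/-! ### The left-hand side, via generating functions in an auxiliary variable `X`. -/

section LeftHandSide

open PowerSeries

variable {K : Type*} [Field K] {q : K}

/-- The generating function of `q ^ (m(m+1)/2) [n over m]_q` over `m`. -/
noncomputable def genBinom (q : K) (n : ℕ) : K⟦X⟧ :=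
  PowerSeries.mk fun m => q ^ (m.choose 2 + m) * gauss q n m

/-- The generating function of `[n + ⌊k/2⌋ over ⌊k/2⌋]_q` over `k`. -/
noncomputable def genHalf (q : K) (n : ℕ) : K⟦X⟧ :=
  PowerSeries.mk fun k => gauss q (n + k / 2) (k / 2)

theorem coeff_mul_one_sub_C_mul_X_zero (f : K⟦X⟧) (a : K) :
    coeff 0 (f * (1 - C a * X)) = coeff 0 f := by
  simp

theorem coeff_succ_mul_one_sub_C_mul_X (f : K⟦X⟧) (a : K) (n : ℕ) :
    coeff (n + 1) (f * (1 - C a * X)) = coeff (n + 1) f - a * coeff n f := by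
  rw [mul_sub, mul_one, map_sub, mul_left_comm, coeff_C_mul, coeff_succ_mul_X]

theorem genBinom_succ (hq : ∀ n : ℕ, q ^ (n + 1) ≠ 1) (n : ℕ) :
    genBinom q (n + 1) = genBinom q n * (1 + C (q ^ (n + 1)) * X) := by
  have h : (1 + C (q ^ (n + 1)) * X : K⟦X⟧) = 1 - C (-q ^ (n + 1)) * X := by simp
  rw [h]
  ext m
  cases m with
  | zero => rw [coeff_mul_one_sub_C_mul_X_zero]; simp [genBinom, gauss_zero_right hq]
  | succ m =>
    rw [coeff_succ_mul_one_sub_C_mul_X]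
    simp only [genBinom, coeff_mk]
    have := pow_choose_mul_gauss_succ hq n m
    rw [pow_add, pow_add]
    linear_combination q ^ (m + 1) * this

/-- Pairing `k = 2j` with `k = 2j + 1` shows that the series is `(1 + X) / (X²;q)_(n+1)`, so raising
`n` adds one factor to the denominator. -/
theorem genHalf_eq (hq : ∀ n : ℕ, q ^ (n + 1) ≠ 1) (n : ℕ) :
    genHalf q n = genHalf q (n + 1) * (1 - C (q ^ (n + 1)) * X ^ 2) := by
  ext k
  rw [mul_sub, mul_one, map_sub, mul_left_comm, coeff_C_mul, coeff_mul_X_pow']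
  rcases lt_or_ge k 2 with h | h
  · have h0 : k / 2 = 0 := by omega
    simp [genHalf, h0, gauss_zero_right hq, not_le.2 h]
  · obtain ⟨k, rfl⟩ := Nat.exists_eq_add_of_le' h
    have h0 : (k + 2) / 2 = k / 2 + 1 := by omega
    rw [if_pos h]
    simp only [genHalf, coeff_mk, h0, Nat.add_sub_cancel]
    have := gauss_succ_succ hq (n + 1 + k / 2) (k / 2)
    rw [Nat.add_sub_cancel] at this
    rw [show n + 1 + (k / 2 + 1) = n + 1 + k / 2 + 1 by ring, this,
      show n + (k / 2 + 1) = n + 1 + k / 2 by ring]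
    ring

theorem genHalf_zero (hq : ∀ n : ℕ, q ^ (n + 1) ≠ 1) :
    genHalf q 0 * (1 - X) = 1 := by
  have h : (genHalf q 0) = PowerSeries.mk 1 := by
    ext k
    simp [genHalf, gauss_self hq]
  rw [h, PowerSeries.mk_one_mul_one_sub_eq_one]

/-- The generating function whose coefficients are the inner sums of the left-hand side over
`m + n₁ + n₂` fixed. It is `(-Xq;q³)_n / ((X;q³)_(n+1) (X/q;q³)_(n+1))`. -/
noncomputable def genInner (q : K) (n : ℕ) : K⟦X⟧ :=
  genBinom q (3 * n) * rescale q⁻¹ (genHalf (q ^ 6) n) * genHalf (q ^ 6) n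

theorem one_add_C_mul_X_ne_zero (a : K) : (1 + C a * X : K⟦X⟧) ≠ 0 := fun h => by
  simpa using congrArg (coeff 0) h

theorem genInner_succ (h0 : q ≠ 0) (hq : ∀ n : ℕ, q ^ (n + 1) ≠ 1) (n : ℕ) :
    genInner q (n + 1) * (1 - C (q ^ (3 * n + 3)) * X) * (1 - C (q ^ (3 * n + 2)) * X) =
      genInner q n * (1 + C (q ^ (3 * n + 1)) * X) := by
  have hq6 : ∀ n : ℕ, (q ^ 6) ^ (n + 1) ≠ 1 := pow_pow_succ_ne_one hq 5
  -- Multiplying by the conjugate factors produces the differences of squares contributed by the two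
  -- `genHalf` series; two of the three new factors of `genBinom` then cancel, and only `1 +
  -- q^(3n+1) X` survives.
  refine mul_right_cancel₀ (one_add_C_mul_X_ne_zero (q ^ (3 * n + 3))) ?_
  refine mul_right_cancel₀ (one_add_C_mul_X_ne_zero (q ^ (3 * n + 2))) ?_
  have e : 3 * (n + 1) = 3 * n + 1 + 1 + 1 := by ring
  have hs : rescale q⁻¹ (genHalf (q ^ 6) n) = rescale q⁻¹ (genHalf (q ^ 6) (n + 1)) *
      (1 - C (q ^ (3 * n + 2)) ^ 2 * X ^ 2) := by
    conv_lhs => rw [genHalf_eq hq6 n]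
    rw [map_mul, map_sub, map_one, map_mul, map_pow _ X, rescale_X, mul_pow, ← mul_assoc]
    congr 3
    have : rescale q⁻¹ (C ((q ^ 6) ^ (n + 1))) = C ((q ^ 6) ^ (n + 1)) := by
      ext i
      rw [coeff_rescale, coeff_C]
      split_ifs with hi <;> simp [hi]
    rw [this, ← map_pow, ← map_mul, ← map_pow]
    congr 1
    field_simp
    ring
  have h6 : genHalf (q ^ 6) n = genHalf (q ^ 6) (n + 1) * (1 - C (q ^ (3 * n + 3)) ^ 2 * X ^ 2) := by
    rw [genHalf_eq hq6 n, ← map_pow]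
    congr 4
    ring
  rw [genInner, genInner, e, genBinom_succ hq, genBinom_succ hq, genBinom_succ hq, hs, h6]
  ring

theorem genInner_zero (hq : ∀ n : ℕ, q ^ (n + 1) ≠ 1) :
    genInner q 0 * (1 - C 1 * X) * (1 - C q⁻¹ * X) = 1 := by
  have hq6 : ∀ n : ℕ, (q ^ 6) ^ (n + 1) ≠ 1 := pow_pow_succ_ne_one hq 5
  have h1 : genBinom q (3 * 0) = 1 := by
    ext m
    cases m with
    | zero => simp [genBinom, gauss_self hq]
    | succ m => simp [genBinom, gauss_of_lt (Nat.succ_pos m), coeff_one]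
  have h2 := genHalf_zero hq6
  have h3 : rescale q⁻¹ (genHalf (q ^ 6) 0) * (1 - C q⁻¹ * X) = 1 := by
    have := congrArg (rescale q⁻¹) h2
    rwa [map_mul, map_sub, map_one, rescale_X] at this
  rw [genInner, h1, map_one, one_mul, one_mul]
  linear_combination (rescale q⁻¹ (genHalf (q ^ 6) 0) * (1 - C q⁻¹ * X)) * h2 + h3

/-- The part of the left-hand side with `m + n₁ + n₂ = M`. -/
noncomputable def lhsLevel (q : K) (N M : ℕ) : K :=
  if M ≤ N then q ^ (3 * M.choose 2 + 2 * M) * coeff M (genInner q (N - M)) else 0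

theorem lhsLevel_of_lt {N M : ℕ} (h : N < M) : lhsLevel q N M = 0 := if_neg (not_le.2 h)

theorem coeff_zero_genInner (hq : ∀ n : ℕ, q ^ (n + 1) ≠ 1) (n : ℕ) :
    coeff 0 (genInner q n) = 1 := by
  have hq6 : ∀ n : ℕ, (q ^ 6) ^ (n + 1) ≠ 1 := pow_pow_succ_ne_one hq 5
  rw [coeff_zero_eq_constantCoeff_apply, genInner, map_mul, map_mul]
  simp only [← coeff_zero_eq_constantCoeff_apply, coeff_rescale]
  simp [genBinom, genHalf, gauss_zero_right hq, gauss_zero_right hq6]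

theorem lhsLevel_zero (hq : ∀ n : ℕ, q ^ (n + 1) ≠ 1) (N : ℕ) : lhsLevel q N 0 = 1 := by
  simp only [lhsLevel, zero_le, if_true, coeff_zero_genInner hq]
  simp

theorem coeff_genInner_zero (hq : ∀ n : ℕ, q ^ (n + 1) ≠ 1) (M : ℕ) :
    coeff (M + 2) (genInner q 0) =
      (1 + q⁻¹) * coeff (M + 1) (genInner q 0) - q⁻¹ * coeff M (genInner q 0) := by
  have h := congrArg (coeff (M + 2)) (genInner_zero hq)
  simp only [coeff_succ_mul_one_sub_C_mul_X, coeff_one] at h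
  rw [if_neg (by omega)] at h
  linear_combination h

theorem coeff_one_genInner_zero (hq : ∀ n : ℕ, q ^ (n + 1) ≠ 1) :
    coeff 1 (genInner q 0) = 1 + q⁻¹ := by
  have h := congrArg (coeff (0 + 1)) (genInner_zero hq)
  rw [coeff_succ_mul_one_sub_C_mul_X, coeff_succ_mul_one_sub_C_mul_X,
    coeff_mul_one_sub_C_mul_X_zero, coeff_zero_genInner hq, coeff_one, if_neg (by omega)] at h
  linear_combination h

theorem coeff_genInner_succ (h0 : q ≠ 0) (hq : ∀ n : ℕ, q ^ (n + 1) ≠ 1) (n M : ℕ) :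
    coeff (M + 2) (genInner q (n + 1)) =
      (q ^ (3 * n + 3) + q ^ (3 * n + 2)) * coeff (M + 1) (genInner q (n + 1)) -
      q ^ (6 * n + 5) * coeff M (genInner q (n + 1)) + coeff (M + 2) (genInner q n) +
      q ^ (3 * n + 1) * coeff (M + 1) (genInner q n) := by
  have h := congrArg (coeff (M + 2)) (genInner_succ h0 hq n)
  have e : (1 + C (q ^ (3 * n + 1)) * X : K⟦X⟧) = 1 - C (-q ^ (3 * n + 1)) * X := by simp
  simp only [e, coeff_succ_mul_one_sub_C_mul_X] at h
  linear_combination h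

theorem coeff_one_genInner_succ (h0 : q ≠ 0) (hq : ∀ n : ℕ, q ^ (n + 1) ≠ 1) (n : ℕ) :
    coeff 1 (genInner q (n + 1)) =
      q ^ (3 * n + 3) + q ^ (3 * n + 2) + q ^ (3 * n + 1) + coeff 1 (genInner q n) := by
  have h := congrArg (coeff (0 + 1)) (genInner_succ h0 hq n)
  have e : (1 + C (q ^ (3 * n + 1)) * X : K⟦X⟧) = 1 - C (-q ^ (3 * n + 1)) * X := by simp
  rw [e, coeff_succ_mul_one_sub_C_mul_X, coeff_succ_mul_one_sub_C_mul_X,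
    coeff_succ_mul_one_sub_C_mul_X, coeff_mul_one_sub_C_mul_X_zero, coeff_zero_genInner hq,
    coeff_zero_genInner hq] at h
  linear_combination h

theorem lhsLevel_one_one (h0 : q ≠ 0) (hq : ∀ n : ℕ, q ^ (n + 1) ≠ 1) :
    lhsLevel q 1 1 = q + q ^ 2 := by
  simp only [lhsLevel, le_refl, if_true, Nat.sub_self, coeff_one_genInner_zero hq]
  simp
  field_simp
  ring

theorem lhsLevel_add_two_one (h0 : q ≠ 0) (hq : ∀ n : ℕ, q ^ (n + 1) ≠ 1) (N : ℕ) :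
    lhsLevel q (N + 2) 1 = lhsLevel q (N + 1) 1 + (q + q ^ 2 + 1) * q ^ (3 * (N + 1)) := by
  rw [lhsLevel, lhsLevel, if_pos (by omega), if_pos (by omega), show N + 2 - 1 = N + 1 by omega,
    Nat.add_sub_cancel, coeff_one_genInner_succ h0 hq]
  simp
  ring

/-- This is the coefficient form of `genInner_succ`; the prefactor `q^(3(M choose 2) + 2M)` turns
its dependence on `N - M` into powers of `q^(3(N+1))` free of `M`. -/
theorem lhsLevel_add_two (h0 : q ≠ 0) (hq : ∀ n : ℕ, q ^ (n + 1) ≠ 1) (N M : ℕ) (h : M ≤ N) :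
    lhsLevel q (N + 2) (M + 2) =
      lhsLevel q (N + 1) (M + 2) + (q + q ^ 2) * q ^ (3 * (N + 1)) * lhsLevel q (N + 1) (M + 1) +
      q ^ (3 * (N + 1)) * lhsLevel q N (M + 1) - q ^ (6 * (N + 1)) * lhsLevel q N M := by
  have e2 : (M + 2).choose 2 = M + 1 + (M + M.choose 2) := by
    rw [choose_succ_two, choose_succ_two]
  rcases h.eq_or_lt with rfl | h
  -- On the boundary `M = N` only `genInner q 0` occurs, and its own recurrence replaces the step in
  -- `n`.
  · rw [lhsLevel_of_lt (Nat.lt_succ_self (M + 1)), lhsLevel_of_lt (Nat.lt_succ_self M)]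
    simp only [lhsLevel, le_refl, if_true, Nat.sub_self, coeff_genInner_zero hq, e2,
      choose_succ_two M]
    field_simp
    ring
  · obtain ⟨k, rfl⟩ := Nat.exists_eq_add_of_lt h
    simp only [lhsLevel]
    rw [if_pos (by omega), if_pos (by omega), if_pos (by omega), if_pos (by omega),
      if_pos (by omega), show M + k + 1 + 2 - (M + 2) = k + 1 by omega,
      show M + k + 1 + 1 - (M + 2) = k by omega, show M + k + 1 + 1 - (M + 1) = k + 1 by omega,
      show M + k + 1 - (M + 1) = k by omega, show M + k + 1 - M = k + 1 by omega,
      coeff_genInner_succ h0 hq, e2, choose_succ_two M]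
    ring

/-- The sum of the levels satisfies the recurrence of the gap partitions. -/
theorem sum_lhsLevel_add_two (h0 : q ≠ 0) (hq : ∀ n : ℕ, q ^ (n + 1) ≠ 1) (N : ℕ) :
    ∑ M ∈ Finset.range (N + 3), lhsLevel q (N + 2) M =
      (1 + (q + q ^ 2) * q ^ (3 * (N + 1))) * ∑ M ∈ Finset.range (N + 2), lhsLevel q (N + 1) M +
      q ^ (3 * (N + 1)) * (1 - q ^ (3 * (N + 1))) * ∑ M ∈ Finset.range (N + 1), lhsLevel q N M := by
  have e1 : ∑ M ∈ Finset.range (N + 1), lhsLevel q (N + 1) (M + 2) =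
      ∑ M ∈ Finset.range (N + 2), lhsLevel q (N + 1) M - lhsLevel q (N + 1) 1 - 1 := by
    rw [Finset.sum_range_succ, lhsLevel_of_lt (Nat.lt_succ_self (N + 1)),
      Finset.sum_range_succ' _ (N + 1), Finset.sum_range_succ' _ N, lhsLevel_zero hq]
    ring
  have e2 : ∑ M ∈ Finset.range (N + 1), lhsLevel q (N + 1) (M + 1) =
      ∑ M ∈ Finset.range (N + 2), lhsLevel q (N + 1) M - 1 := by
    rw [Finset.sum_range_succ' _ (N + 1), lhsLevel_zero hq]
    ring
  have e3 : ∑ M ∈ Finset.range (N + 1), lhsLevel q N (M + 1) =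
      ∑ M ∈ Finset.range (N + 1), lhsLevel q N M - 1 := by
    rw [Finset.sum_range_succ, lhsLevel_of_lt (Nat.lt_succ_self N), Finset.sum_range_succ' _ N,
      lhsLevel_zero hq]
    ring
  -- Levels `0` and `1` are split off; their contribution cancels exactly the corrections in `e1`,
  -- `e2` and `e3` caused by the shifted indices.
  rw [Finset.sum_range_succ' _ (N + 2), Finset.sum_range_succ' _ (N + 1), lhsLevel_zero hq,
    lhsLevel_add_two_one h0 hq, Finset.sum_congr rfl fun M hM =>
      lhsLevel_add_two h0 hq N M (Nat.lt_succ_iff.1 (Finset.mem_range.1 hM)),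
    Finset.sum_sub_distrib, Finset.sum_add_distrib, Finset.sum_add_distrib, ← Finset.mul_sum,
    ← Finset.mul_sum, ← Finset.mul_sum, e1, e2, e3]
  ring

/-- With `M = m + n₁ + n₂` fixed, what remains is a quadratic in `m` alone and the linear term
`-n₁`; the latter is the reason for rescaling one `genHalf` by `q⁻¹`. -/
theorem expA_eq (n₁ n₂ m : ℕ) :
    expA n₁ n₂ m = ((3 * (m + n₁ + n₂).choose 2 + 2 * (m + n₁ + n₂) + (m.choose 2 + m) : ℕ) : ℤ)
      - n₁ := by
  have h : ((2 * m + n₁ + n₂ + 1) * (2 * m + n₁ + n₂) / 2 : ℤ) =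
      ((2 * m + n₁ + n₂ + 1).choose 2 : ℕ) := by
    have := two_mul_choose_two (2 * m + n₁ + n₂ + 1)
    push_cast at this
    rw [add_sub_cancel_right] at this
    omega
  have h1 := two_mul_choose_two (2 * m + n₁ + n₂ + 1)
  have h2 := two_mul_choose_two (m + n₁ + n₂)
  have h3 := two_mul_choose_two m
  rw [expA, h]
  push_cast at *
  linarith

theorem lhsTerm_eq (h0 : q ≠ 0) {N m n₁ n₂ : ℕ} (h : m + n₁ + n₂ ≤ N) :
    lhsTerm q N m n₁ n₂ = q ^ (3 * (m + n₁ + n₂).choose 2 + 2 * (m + n₁ + n₂)) *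
      (coeff m (genBinom q (3 * (N - (m + n₁ + n₂)))) *
        coeff n₁ (rescale q⁻¹ (genHalf (q ^ 6) (N - (m + n₁ + n₂)))) *
        coeff n₂ (genHalf (q ^ 6) (N - (m + n₁ + n₂)))) := by
  obtain ⟨n, rfl⟩ := Nat.exists_eq_add_of_le h
  have e : ((m + n₁ + n₂ + n : ℕ) : ℤ) - m - n₁ - n₂ = n := by push_cast; ring
  rw [lhsTerm, e, expA_eq, Nat.add_sub_cancel_left]
  simp only [coeff_rescale, genBinom, genHalf, coeff_mk, gauss]
  rw [zpow_sub₀ h0, zpow_natCast, zpow_natCast, pow_add, inv_pow]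
  push_cast
  field_simp

theorem lhs_eq_sum (h0 : q ≠ 0) (N : ℕ) :
    lhs q N = ∑ M ∈ Finset.range (N + 1), lhsLevel q N M := by
  have h1 : ∀ M ∈ Finset.range (N + 1), lhsLevel q N M =
      ∑ u ∈ Finset.HasAntidiagonal.antidiagonal M, ∑ v ∈ Finset.HasAntidiagonal.antidiagonal u.1, lhsTerm q N v.1 v.2 u.2 := by
    intro M hM
    have hM : M ≤ N := Nat.lt_succ_iff.1 (Finset.mem_range.1 hM)
    rw [lhsLevel, if_pos hM, genInner, coeff_mul, Finset.mul_sum]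
    refine Finset.sum_congr rfl fun u hu => ?_
    rw [coeff_mul, Finset.sum_mul, Finset.mul_sum]
    refine Finset.sum_congr rfl fun v hv => ?_
    rw [Finset.HasAntidiagonal.mem_antidiagonal] at hu hv
    have e : v.1 + v.2 + u.2 = M := by omega
    rw [lhsTerm_eq h0 (by omega), e]
  rw [Finset.sum_congr rfl h1, Finset.sum_sigma', Finset.sum_sigma', lhs]
  rw [finsum_eq_sum_of_support_subset (s := ((Finset.range (N + 1)) ×ˢ (Finset.range (N + 1)) ×ˢ
    (Finset.range (N + 1))).filter fun t => t.1 + t.2.1 + t.2.2 ≤ N)]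
  · refine Finset.sum_bij' (fun t _ => ⟨⟨t.1 + t.2.1 + t.2.2, (t.1 + t.2.1, t.2.2)⟩, (t.1, t.2.1)⟩)
      (fun w _ => (w.2.1, w.2.2, w.1.2.2)) ?_ ?_ ?_ ?_ ?_
    · rintro ⟨m, a, b⟩ ht
      simp at ht ⊢
      omega
    · rintro ⟨⟨M, u⟩, v⟩ ht
      simp at ht ⊢
      omega
    · rintro ⟨m, a, b⟩ ht
      rfl
    · rintro ⟨⟨M, u, b⟩, m, a⟩ ht
      simp at ht ⊢
      obtain ⟨⟨_, rfl⟩, rfl⟩ := ht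
      simp
    · rintro ⟨m, a, b⟩ ht
      rfl
  · intro t ht
    have := mt (lhsTerm_eq_zero q N t.1 t.2.1 t.2.2) ht
    simp
    omega

theorem lhs_zero (h0 : q ≠ 0) (hq : ∀ n : ℕ, q ^ (n + 1) ≠ 1) : lhs q (0 : ℕ) = 1 := by
  rw [lhs_eq_sum h0, Finset.sum_range_one, lhsLevel_zero hq]

theorem lhs_one (h0 : q ≠ 0) (hq : ∀ n : ℕ, q ^ (n + 1) ≠ 1) :
    lhs q (1 : ℕ) = 1 + q + q ^ 2 := by
  rw [lhs_eq_sum h0, Finset.sum_range_succ, Finset.sum_range_one, lhsLevel_zero hq,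
    lhsLevel_one_one h0 hq, add_assoc]

theorem lhs_add_two (h0 : q ≠ 0) (hq : ∀ n : ℕ, q ^ (n + 1) ≠ 1) (N : ℕ) :
    lhs q (N + 2 : ℕ) = (1 + (q + q ^ 2) * q ^ (3 * (N + 1))) * lhs q (N + 1 : ℕ) +
      q ^ (3 * (N + 1)) * (1 - q ^ (3 * (N + 1))) * lhs q (N : ℕ) := by
  rw [lhs_eq_sum h0, lhs_eq_sum h0, lhs_eq_sum h0, sum_lhsLevel_add_two h0 hq]

end LeftHandSide

end SchurIdentity

namespace SchurIdentity

/-! ### The right-hand side: collapse to a single sum, recurrence, product limit. -/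

section RightHandSide

variable {K : Type*} [Field K] {p x y q : K}

/-- The sum `∑ p ^ (a(a-1)/2) [N over a]_p x ^ a (-y;p)_(N-a)`. -/
noncomputable def binomSum (p x y : K) (N : ℕ) : K :=
  ∑ a ∈ Finset.range (N + 1),
    p ^ a.choose 2 * gauss p N a * x ^ a * ∏ i ∈ Finset.range (N - a), (1 + y * p ^ i)

/-- A companion of `binomSum`, in which the `q`-Pochhammer symbol lags behind. -/
noncomputable def binomSumLag (p x y z : K) (N l : ℕ) : K :=
  ∑ a ∈ Finset.range (N + 1),
    p ^ a.choose 2 * gauss p N a * x ^ a * z ^ a * ∏ i ∈ Finset.range (N + l - a), (1 + y * p ^ i)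

theorem binomSumLag_one (hp0 : p ≠ 0) (N : ℕ) :
    binomSumLag p x y 1 N 1 =
      binomSum p x y N + y * p ^ N * binomSumLag p x y p⁻¹ N 0 := by
  rw [binomSumLag, binomSum, binomSumLag, Finset.mul_sum, ← Finset.sum_add_distrib]
  refine Finset.sum_congr rfl fun a ha => ?_
  have ha : a ≤ N := Nat.lt_succ_iff.1 (Finset.mem_range.1 ha)
  obtain ⟨n, rfl⟩ := Nat.exists_eq_add_of_le ha
  rw [show a + n + 1 - a = n + 1 by omega, show a + n + 0 - a = n by omega,
    show a + n - a = n by omega, Finset.prod_range_succ, one_pow, pow_add p a n, inv_pow]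
  field_simp

theorem binomSum_succ (hp : ∀ n : ℕ, p ^ (n + 1) ≠ 1) (N : ℕ) :
    binomSum p x y (N + 1) = binomSumLag p x y 1 N 1 + x * p ^ N * binomSum p x y N := by
  conv_rhs => rw [binomSumLag, Finset.sum_range_succ', binomSum, Finset.mul_sum]
  rw [binomSum, Finset.sum_range_succ']
  simp only [pow_choose_mul_gauss_succ hp, add_mul, Finset.sum_add_distrib]
  rw [Finset.sum_range_succ, gauss_of_lt (Nat.lt_succ_self N)]
  simp only [Nat.add_sub_add_right, one_pow, mul_one, gauss_zero_right hp]
  have h : ∀ a, p ^ N * (p ^ a.choose 2 * gauss p N a) * x ^ (a + 1) *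
      ∏ i ∈ Finset.range (N - a), (1 + y * p ^ i) = x * p ^ N *
      (p ^ a.choose 2 * gauss p N a * x ^ a * ∏ i ∈ Finset.range (N - a), (1 + y * p ^ i)) :=
    fun a => by ring
  simp only [h]
  ring

/-- The choice `z = p⁻¹` cancels the powers of `p` depending on `a` that the second Pascal rule
introduces. -/
theorem binomSumLag_succ (hp0 : p ≠ 0) (hp : ∀ n : ℕ, p ^ (n + 1) ≠ 1) (N : ℕ) :
    binomSumLag p x y p⁻¹ (N + 1) 0 =
      binomSumLag p x y 1 N 1 + x * p⁻¹ * binomSum p x y N := by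
  conv_rhs => rw [binomSumLag, Finset.sum_range_succ', binomSum, Finset.mul_sum]
  rw [binomSumLag, Finset.sum_range_succ']
  simp only [pow_choose_mul_gauss_succ' hp, add_mul, Finset.sum_add_distrib]
  rw [Finset.sum_range_succ, gauss_of_lt (Nat.lt_succ_self N)]
  simp only [Nat.add_sub_add_right, one_pow, mul_one, gauss_zero_right hp, add_zero, inv_pow]
  have h : ∀ a, p ^ a * (p ^ a.choose 2 * gauss p N a) * x ^ (a + 1) * (p ^ (a + 1))⁻¹ *
      ∏ i ∈ Finset.range (N - a), (1 + y * p ^ i) = x * p⁻¹ *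
      (p ^ a.choose 2 * gauss p N a * x ^ a * ∏ i ∈ Finset.range (N - a), (1 + y * p ^ i)) :=
    fun a => by field_simp; ring
  have h' : ∀ a, p ^ (a + 1) * (p ^ (a + 1).choose 2 * gauss p N (a + 1)) * x ^ (a + 1) *
      (p ^ (a + 1))⁻¹ * ∏ i ∈ Finset.range (N - a), (1 + y * p ^ i) =
      p ^ (a + 1).choose 2 * gauss p N (a + 1) * x ^ (a + 1) *
        ∏ i ∈ Finset.range (N - a), (1 + y * p ^ i) :=
    fun a => by field_simp
  simp only [h, h']
  simp
  ring

/-- The preceding relations form a first-order linear system for `binomSum` and its lagging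
companions; eliminating the companions leaves a second-order recurrence. -/
theorem binomSum_add_two (hp0 : p ≠ 0) (hp : ∀ n : ℕ, p ^ (n + 1) ≠ 1) (N : ℕ) :
    binomSum p x y (N + 2) = (1 + (x + y) * p ^ (N + 1)) * binomSum p x y (N + 1) +
      x * y * p ^ N * (1 - p ^ (N + 1)) * binomSum p x y N := by
  have h1 := binomSum_succ hp (x := x) (y := y) (N + 1)
  have h2 := binomSumLag_one hp0 (x := x) (y := y) (N + 1)
  have h3 := binomSumLag_succ hp0 hp (x := x) (y := y) N
  have h4 := binomSum_succ hp (x := x) (y := y) N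
  have h5 : p ^ (N + 1) * p⁻¹ = p ^ N := by rw [pow_succ, mul_inv_cancel_right₀ hp0]
  rw [h1, h2, h3]
  linear_combination (-y * p ^ (N + 1)) * h4 + x * y * binomSum p x y N * h5

theorem binomSum_zero (hp : ∀ n : ℕ, p ^ (n + 1) ≠ 1) : binomSum p x y 0 = 1 := by
  simp [binomSum, gauss_zero_right hp]

theorem binomSum_one (hp : ∀ n : ℕ, p ^ (n + 1) ≠ 1) : binomSum p x y 1 = 1 + x + y := by
  simp [binomSum, gauss_zero_right hp, gauss_self hp, Finset.sum_range_succ]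
  ring

theorem qBinom_of_neg {a m : ℤ} (h : m < 0) : qBinom q a m = 0 := if_neg fun hc => by omega

theorem qBinom_of_lt {a m : ℤ} (h : a < m) : qBinom q a m = 0 := if_neg fun hc => by omega

theorem qTrinom_eq_sum (p : K) (N : ℕ) (b a : ℤ) :
    qTrinom p N b a = ∑ k ∈ Finset.range (N + 1),
      p ^ ((k : ℤ) * (k + b)) * gauss p N k * qBinom p (N - k) (k + a) := by
  refine finsum_eq_sum_of_support_subset _ fun k hk => ?_
  by_contra h
  refine hk ?_
  have h0 : qBinom p N k = 0 := qBinom_of_lt (by simp at h; omega)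
  simp [h0]

theorem pentagonal_exponent (a b : ℕ) :
    (((b : ℤ) - a) * (3 * ((b : ℤ) - a) - 1) / 2 : ℤ) + 3 * ((a : ℤ) * (a + ((b : ℤ) - a))) =
      ((3 * a.choose 2 + 2 * a + (3 * b.choose 2 + b) : ℕ) : ℤ) := by
  have h1 := two_mul_choose_two a
  have h2 := two_mul_choose_two b
  have h : (((b : ℤ) - a) * (3 * ((b : ℤ) - a) - 1) : ℤ) =
    2 * (((3 * a.choose 2 + 2 * a + (3 * b.choose 2 + b) : ℕ) : ℤ) -
      3 * ((a : ℤ) * (a + ((b : ℤ) - a)))) := by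
    push_cast
    linear_combination (-3) * h1 - 3 * h2
  rw [h, Int.mul_ediv_cancel_left _ two_ne_zero]
  ring

/-- After exchanging the sums, the trinomial index becomes `a` and `j = b - a`, where `b` is the
index in the `q`-binomial expansion of `(-q;q³)_(N-a)`. By `pentagonal_exponent` the exponent then
separates in `a` and `b`. -/
theorem rhs_eq_binomSum (h0 : q ≠ 0) (hq : ∀ n : ℕ, q ^ (n + 1) ≠ 1) (N : ℕ) :
    rhs q N = binomSum (q ^ 3) (q ^ 2) q N := by
  have hq3 : ∀ n : ℕ, (q ^ 3) ^ (n + 1) ≠ 1 := fun n => by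
    rw [← pow_mul, show 3 * (n + 1) = 3 * n + 2 + 1 by ring]
    exact hq _
  simp only [rhs, qTrinom_eq_sum, Finset.mul_sum]
  rw [Finset.sum_comm, binomSum]
  refine Finset.sum_congr rfl fun a ha => ?_
  have ha : a ≤ N := Nat.lt_succ_iff.1 (Finset.mem_range.1 ha)
  rw [prod_one_add_mul_pow hq3, Finset.mul_sum]
  symm
  refine Finset.sum_of_injOn (fun b : ℕ => (b : ℤ) - a) ?_ ?_ ?_ ?_
  · intro b _ c _ h
    simpa using h
  · intro b hb
    simp at hb ⊢
    omega
  · intro j hj hj'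
    have : qBinom (q ^ 3) (N - a : ℤ) (a + j) = 0 := by
      rcases lt_or_ge ((a : ℤ) + j) 0 with h | h
      · exact qBinom_of_neg h
      · refine qBinom_of_lt ?_
        by_contra hc
        refine hj' ⟨(a + j).toNat, ?_, ?_⟩
        · simp
          omega
        · simp [h]
    rw [this, mul_zero, mul_zero]
  · intro b hb
    have e : qBinom (q ^ 3) (N - a : ℤ) (a + ((b : ℤ) - a)) = gauss (q ^ 3) (N - a) b := by
      rw [gauss, Nat.cast_sub ha, add_sub_cancel]
    have e' := pentagonal_exponent a b
    have e2 : q ^ (((b : ℤ) - a) * (3 * ((b : ℤ) - a) - 1) / 2 : ℤ) *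
        (q ^ 3) ^ ((a : ℤ) * (a + ((b : ℤ) - a))) =
        q ^ (3 * a.choose 2 + 2 * a + (3 * b.choose 2 + b)) := by
      rw [← zpow_natCast q 3, ← zpow_mul, ← zpow_add₀ h0, ← zpow_natCast, ← e']
      rfl
    rw [e]
    linear_combination (-gauss (q ^ 3) N a * gauss (q ^ 3) (N - a) b) * e2

theorem rhs_zero (h0 : q ≠ 0) (hq : ∀ n : ℕ, q ^ (n + 1) ≠ 1) : rhs q (0 : ℕ) = 1 := by
  rw [rhs_eq_binomSum h0 hq, binomSum_zero (pow_pow_succ_ne_one hq 2)]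

theorem rhs_one (h0 : q ≠ 0) (hq : ∀ n : ℕ, q ^ (n + 1) ≠ 1) :
    rhs q (1 : ℕ) = 1 + q + q ^ 2 := by
  rw [rhs_eq_binomSum h0 hq, binomSum_one (pow_pow_succ_ne_one hq 2)]
  ring

theorem rhs_add_two (h0 : q ≠ 0) (hq : ∀ n : ℕ, q ^ (n + 1) ≠ 1) (N : ℕ) :
    rhs q (N + 2 : ℕ) = (1 + (q + q ^ 2) * q ^ (3 * (N + 1))) * rhs q (N + 1 : ℕ) +
      q ^ (3 * (N + 1)) * (1 - q ^ (3 * (N + 1))) * rhs q (N : ℕ) := by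
  rw [rhs_eq_binomSum h0 hq, rhs_eq_binomSum h0 hq, rhs_eq_binomSum h0 hq,
    binomSum_add_two (pow_ne_zero 3 h0) (pow_pow_succ_ne_one hq 2)]
  ring

/-- The sums `binomSum` approximate the infinite product. -/
theorem binomSum_sub_mem (S : Subring K) (hq : q ∈ S) (hp : ∀ n : ℕ, (q ^ 3) ^ (n + 1) ≠ 1)
    (N : ℕ) : ∃ s ∈ S, binomSum (q ^ 3) (q ^ 2) q N -
      (∏ i ∈ Finset.range N, (1 + q ^ 2 * (q ^ 3) ^ i)) *
        ∏ i ∈ Finset.range N, (1 + q * (q ^ 3) ^ i) = q ^ N * s := by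
  -- `S` need not be closed under division, so membership comes from the Pascal rule rather than
  -- from the defining quotient.
  have hgauss : ∀ n k : ℕ, gauss (q ^ 3) n k ∈ S := by
    intro n
    induction n with
    | zero =>
      rintro (_ | k)
      · rw [gauss_self hp]; exact S.one_mem
      · rw [gauss_of_lt (Nat.succ_pos k)]; exact S.zero_mem
    | succ n ih =>
      rintro (_ | k)
      · rw [gauss_zero_right hp]; exact S.one_mem
      · rw [gauss_succ_succ hp]
        exact S.add_mem (ih _) (S.mul_mem (S.pow_mem (S.pow_mem hq _) _) (ih _))
  have hprod : ∀ n m : ℕ, ∃ s ∈ S, ∏ i ∈ Finset.range (n + m), (1 + q * (q ^ 3) ^ i) =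
      ∏ i ∈ Finset.range n, (1 + q * (q ^ 3) ^ i) + q ^ n * s := by
    intro n m
    induction m with
    | zero => exact ⟨0, S.zero_mem, by simp⟩
    | succ m ih =>
      obtain ⟨s, hs, h⟩ := ih
      refine ⟨s + q ^ (2 * n + 3 * m + 1) * ∏ i ∈ Finset.range (n + m), (1 + q * (q ^ 3) ^ i),
        S.add_mem hs (S.mul_mem (S.pow_mem hq _) (S.prod_mem fun i _ => S.add_mem S.one_mem
          (S.mul_mem hq (S.pow_mem (S.pow_mem hq _) _)))), ?_⟩
      rw [← add_assoc, Finset.prod_range_succ, mul_add, mul_one]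
      nth_rw 1 [h]
      ring
  -- Only the first product is expanded. In the `a`-th term, replacing the product of length `N - a`
  -- by that of length `N` costs a multiple of `q^(N-a)`, and the factor `(q²)^a` more than makes up
  -- for the missing `q^a`.
  rw [prod_one_add_mul_pow hp, binomSum, Finset.sum_mul, ← Finset.sum_sub_distrib]
  refine Finset.sum_induction _ (fun r => ∃ s ∈ S, r = q ^ N * s) ?_ ⟨0, S.zero_mem, by simp⟩ ?_
  · rintro _ _ ⟨s, hs, rfl⟩ ⟨t, ht, rfl⟩
    exact ⟨s + t, S.add_mem hs ht, by ring⟩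
  · intro a ha
    obtain ⟨n, rfl⟩ := Nat.exists_eq_add_of_le (Nat.lt_succ_iff.1 (Finset.mem_range.1 ha))
    obtain ⟨s, hs, h⟩ := hprod n a
    rw [add_comm n a] at h
    refine ⟨-((q ^ 3) ^ a.choose 2 * gauss (q ^ 3) (a + n) a * q ^ a * s),
      S.neg_mem (S.mul_mem (S.mul_mem (S.mul_mem (S.pow_mem (S.pow_mem hq _) _) (hgauss _ _))
        (S.pow_mem hq _)) hs), ?_⟩
    rw [h, Nat.add_sub_cancel_left]
    ring

end RightHandSide

end SchurIdentity

namespace SchurIdentity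

/-! ### Combinatorics: gap sets, distinct parts, and their generating polynomials. -/

section GapSets

/-- The gap conditions of Schur's theorem for a set of parts. -/
def IsGapSet (s : Finset ℕ) : Prop :=
  ∀ a ∈ s, ∀ b ∈ s, a < b → a + 3 ≤ b ∧ (3 ∣ a → 3 ∣ b → a + 6 ≤ b)

open Classical in
/-- The sets of positive parts at most `M` that satisfy the gap conditions. -/
noncomputable def gapSets (M : ℕ) : Finset (Finset ℕ) :=
  (Finset.Icc 1 M).powerset.filter IsGapSet

theorem mem_gapSets {M : ℕ} {s : Finset ℕ} :
    s ∈ gapSets M ↔ (∀ a ∈ s, 1 ≤ a ∧ a ≤ M) ∧ IsGapSet s := by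
  simp [gapSets, Finset.subset_iff]

theorem IsGapSet.mono {s t : Finset ℕ} (h : IsGapSet t) (hst : s ⊆ t) : IsGapSet s :=
  fun a ha b hb => h a (hst ha) b (hst hb)

/-- The generating function of a family of sets by the sum of their elements. -/
def sumGen {R : Type*} [CommRing R] (q : R) (F : Finset (Finset ℕ)) : R :=
  ∑ s ∈ F, q ^ ∑ i ∈ s, i

/-- Split the gap sets by whether they contain the largest admissible part. -/
theorem sumGen_gapSets_succ {R : Type*} [CommRing R] (q : R) {M L : ℕ} (hL : L ≤ M)
    (h : ∀ a, 1 ≤ a → a ≤ M →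
      (a ≤ L ↔ a + 3 ≤ M + 1 ∧ (3 ∣ a → 3 ∣ M + 1 → a + 6 ≤ M + 1))) :
    sumGen q (gapSets (M + 1)) =
      sumGen q (gapSets M) + q ^ (M + 1) * sumGen q (gapSets L) := by
  rw [sumGen, ← Finset.sum_filter_not_add_sum_filter _ (fun s => M + 1 ∈ s)]
  congr 1
  · refine Finset.sum_congr ?_ fun _ _ => rfl
    ext s
    simp only [Finset.mem_filter, mem_gapSets]
    constructor
    · rintro ⟨⟨h1, h2⟩, h3⟩
      refine ⟨fun a ha => ⟨(h1 a ha).1, ?_⟩, h2⟩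
      have : a ≠ M + 1 := fun e => h3 (e ▸ ha)
      have := (h1 a ha).2
      omega
    · rintro ⟨h1, h2⟩
      refine ⟨⟨fun a ha => ⟨(h1 a ha).1, (h1 a ha).2.trans (Nat.le_succ M)⟩, h2⟩, fun hs => ?_⟩
      have := (h1 _ hs).2
      omega
  · rw [sumGen, Finset.mul_sum]
    refine Finset.sum_bij' (fun s _ => s.erase (M + 1)) (fun s _ => insert (M + 1) s) ?_ ?_ ?_ ?_ ?_
    · intro s hs
      simp only [Finset.mem_filter, mem_gapSets] at hs ⊢
      obtain ⟨⟨h1, h2⟩, h3⟩ := hs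
      refine ⟨fun a ha => ?_, h2.mono (Finset.erase_subset _ _)⟩
      obtain ⟨ha, ha'⟩ := Finset.mem_erase.1 ha
      have h4 := h1 a ha'
      have h5 : a ≤ M := by omega
      exact ⟨h4.1, (h a h4.1 h5).2 (h2 a ha' _ h3 (by omega))⟩
    · intro s hs
      simp only [Finset.mem_filter, mem_gapSets] at hs ⊢
      obtain ⟨h1, h2⟩ := hs
      refine ⟨⟨fun a ha => ?_, fun a ha b hb hab => ?_⟩, Finset.mem_insert_self _ _⟩
      · rcases Finset.mem_insert.1 ha with rfl | ha
        · omega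
        · have := h1 a ha
          omega
      · rcases Finset.mem_insert.1 ha with rfl | ha
        · rcases Finset.mem_insert.1 hb with rfl | hb
          · omega
          · have := h1 b hb
            omega
        · have h3 := h1 a ha
          rcases Finset.mem_insert.1 hb with rfl | hb
          · exact (h a h3.1 (by omega)).1 h3.2
          · exact h2 a ha b hb hab
    · intro s hs
      exact Finset.insert_erase (Finset.mem_filter.1 hs).2
    · intro s hs
      refine Finset.erase_insert fun hc => ?_
      have := ((mem_gapSets.1 hs).1 _ hc).2
      omega
    · intro s hs
      rw [← pow_add, Finset.add_sum_erase s (fun i => i) (Finset.mem_filter.1 hs).2]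

theorem sumGen_gapSets_zero {R : Type*} [CommRing R] (q : R) : sumGen q (gapSets 0) = 1 := by
  have h : gapSets 0 = {∅} := by
    ext s
    rw [mem_gapSets, Finset.mem_singleton]
    constructor
    · rintro ⟨h, -⟩
      refine Finset.eq_empty_of_forall_notMem fun a ha => ?_
      have := h a ha
      omega
    · rintro rfl
      exact ⟨by simp, by simp [IsGapSet]⟩
  simp [sumGen, h]

theorem sumGen_gapSets_two {R : Type*} [CommRing R] (q : R) :
    sumGen q (gapSets 2) = 1 + q + q ^ 2 := by
  rw [sumGen_gapSets_succ q (M := 1) (L := 0) (by omega) (by omega),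
    sumGen_gapSets_succ q (M := 0) (L := 0) (by omega) (by omega), sumGen_gapSets_zero]
  ring

/-- Below a largest part `P` the other parts are bounded by `P - 3`, or by `P - 4` if `3 ∣ P`, since
`P - 3` is then excluded too. This is used for the parts `3N + 5`, `3N + 4` and `3N + 3`, and `h4`
eliminates the bound `3N + 1`. At `N = 0` the truncated `3 * N - 1 = 0` correctly admits only the
empty set. -/
theorem sumGen_gapSets_add_two {R : Type*} [CommRing R] (q : R) (N : ℕ) :
    sumGen q (gapSets (3 * (N + 2) - 1)) =
      (1 + (q + q ^ 2) * q ^ (3 * (N + 1))) * sumGen q (gapSets (3 * (N + 1) - 1)) +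
      q ^ (3 * (N + 1)) * (1 - q ^ (3 * (N + 1))) * sumGen q (gapSets (3 * N - 1)) := by
  have h1 := sumGen_gapSets_succ q (M := 3 * N + 4) (L := 3 * N + 2) (by omega) (by omega)
  have h2 := sumGen_gapSets_succ q (M := 3 * N + 3) (L := 3 * N + 1) (by omega) (by omega)
  have h3 := sumGen_gapSets_succ q (M := 3 * N + 2) (L := 3 * N - 1) (by omega) (by omega)
  have h4 := sumGen_gapSets_succ q (M := 3 * N + 1) (L := 3 * N - 1) (by omega) (by omega)
  simp only [add_assoc, Nat.reduceAdd] at h1 h2 h3 h4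
  rw [show 3 * (N + 2) - 1 = 3 * N + 5 by omega, show 3 * (N + 1) - 1 = 3 * N + 2 by omega]
  rw [h1, h2, h3]
  linear_combination (-q ^ (3 * N + 4)) * h4

theorem map_sumGen {R S : Type*} [CommRing R] [CommRing S] (f : R →+* S) (q : R)
    (F : Finset (Finset ℕ)) : f (sumGen q F) = sumGen (f q) F := by
  simp [sumGen]

theorem coeff_sumGen (F : Finset (Finset ℕ)) (n : ℕ) :
    PowerSeries.coeff n (sumGen (PowerSeries.X : PowerSeries ℚ) F) =
      (F.filter fun s => ∑ i ∈ s, i = n).card := by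
  simp [sumGen, PowerSeries.coeff_X_pow, Finset.sum_boole, eq_comm]

/-- Partitions into distinct parts correspond to finite sets of positive integers. -/
theorem card_partition_eq {n : ℕ} (P : Nat.Partition n → Prop) (F : Finset (Finset ℕ))
    (h0 : ∀ s ∈ F, 0 ∉ s) (hP : ∀ p, P p ↔ p.parts.Nodup ∧ p.parts.toFinset ∈ F) :
    Nat.card {p // P p} = (F.filter fun s => ∑ i ∈ s, i = n).card := by
  rw [← Fintype.card_coe, ← Nat.card_eq_fintype_card]
  refine Nat.card_congr
    { toFun := fun p => ⟨p.1.parts.toFinset, ?_⟩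
      invFun := fun s => ⟨⟨s.1.val, fun {i} hi => ?_, ?_⟩, ?_⟩
      left_inv := fun p => ?_
      right_inv := fun s => ?_ }
  · obtain ⟨h1, h2⟩ := (hP p.1).1 p.2
    refine Finset.mem_filter.2 ⟨h2, ?_⟩
    rw [Finset.sum_eq_multiset_sum, Multiset.toFinset_val, h1.dedup, Multiset.map_id',
      p.1.parts_sum]
  · refine Nat.pos_of_ne_zero ?_
    rintro rfl
    exact h0 _ (Finset.mem_filter.1 s.2).1 hi
  · have := (Finset.mem_filter.1 s.2).2
    rwa [Finset.sum_eq_multiset_sum, Multiset.map_id'] at this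
  · refine (hP _).2 ⟨s.1.nodup, ?_⟩
    rw [Finset.val_toFinset]
    exact (Finset.mem_filter.1 s.2).1
  · refine Subtype.ext (Nat.Partition.ext ?_)
    exact ((hP p.1).1 p.2).1.dedup
  · exact Subtype.ext (Finset.val_toFinset s.1)

theorem isSchurGap_iff {n : ℕ} (p : Nat.Partition n) :
    IsSchurGap p ↔ p.parts.Nodup ∧ IsGapSet p.parts.toFinset := by
  simp only [IsSchurGap, IsGapSet, Multiset.mem_toFinset]

theorem gapCountLE_eq (M n : ℕ) :
    gapCountLE M n = ((gapSets M).filter fun s => ∑ i ∈ s, i = n).card := by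
  refine card_partition_eq _ _ (fun s hs h0 => ?_) fun p => ?_
  · have := (mem_gapSets.1 hs).1 0 h0
    omega
  · rw [isSchurGap_iff, mem_gapSets, and_assoc, and_comm (a := IsGapSet _)]
    refine and_congr_right fun _ => and_congr_left fun _ => ?_
    simp only [Multiset.mem_toFinset]
    exact forall₂_congr fun a ha => ⟨fun h => ⟨p.parts_pos ha, h⟩, And.right⟩

theorem gapCountLE_of_le {M n : ℕ} (h : n ≤ M) : gapCountLE M n = gapCount n := by
  refine Nat.card_congr (Equiv.subtypeEquivRight fun p => and_iff_left fun a ha => ?_)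
  exact (Nat.Partition.le_of_mem_parts ha).trans h

/-- The positive integers below `3 * N` that are not divisible by `3`. -/
def nonMultiples (N : ℕ) : Finset ℕ := (Finset.range (3 * N)).filter fun j => ¬ 3 ∣ j

theorem distinctCount_eq {N n : ℕ} (h : n < 3 * N) :
    distinctCount n = ((nonMultiples N).powerset.filter fun s => ∑ i ∈ s, i = n).card := by
  refine card_partition_eq _ _ (fun s hs h0 => ?_) fun p => ?_
  · have := Finset.mem_powerset.1 hs h0
    simp [nonMultiples] at this
  · refine and_congr_right fun _ => ?_
    simp only [Finset.mem_powerset, Finset.subset_iff, Multiset.mem_toFinset, nonMultiples,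
      Finset.mem_filter, Finset.mem_range]
    refine forall₂_congr fun a ha => ?_
    have := Nat.Partition.le_of_mem_parts ha
    simp only [Int.ModEq]
    omega

theorem prod_eq_sumGen {R : Type*} [CommRing R] (q : R) (N : ℕ) :
    (∏ i ∈ Finset.range N, (1 + q ^ 2 * (q ^ 3) ^ i)) *
      ∏ i ∈ Finset.range N, (1 + q * (q ^ 3) ^ i) = sumGen q (nonMultiples N).powerset := by
  have h : sumGen q (nonMultiples N).powerset = ∏ j ∈ nonMultiples N, (1 + q ^ j) := by
    rw [Finset.prod_one_add]
    exact Finset.sum_congr rfl fun s _ => (Finset.prod_pow_eq_pow_sum s (fun i => i) q).symm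
  rw [h, nonMultiples, Finset.prod_filter]
  clear h
  induction N with
  | zero => simp
  | succ N ih =>
    rw [show 3 * (N + 1) = 3 * N + 1 + 1 + 1 by ring, Finset.prod_range_succ _ (3 * N + 1 + 1),
      Finset.prod_range_succ _ (3 * N + 1), Finset.prod_range_succ _ (3 * N), Finset.prod_range_succ,
      Finset.prod_range_succ, ← ih, if_neg (by omega), if_pos (by omega), if_pos (by omega)]
    ring

end GapSets

end SchurIdentity

namespace SchurIdentity

/-! ### Comparison of the three sequences in Laurent series, and the limit. -/

section Main

theorem qVar_ne_zero : qVar ≠ 0 := fun h =>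
  PowerSeries.X_ne_zero (R := ℚ) (HahnSeries.ofPowerSeries_injective (h.trans (map_zero _).symm))

theorem qVar_pow_ne_one (n : ℕ) : qVar ^ (n + 1) ≠ 1 := fun h => by
  have h' : (PowerSeries.X : PowerSeries ℚ) ^ (n + 1) = 1 :=
    HahnSeries.ofPowerSeries_injective (Γ := ℤ)
      (((map_pow _ _ _).trans h).trans (map_one _).symm)
  have := congrArg (PowerSeries.coeff 0) h'
  simp at this

theorem genSeries_eq_sumGen {c : ℕ → ℕ} {F : Finset (Finset ℕ)}
    (h : ∀ n, c n = (F.filter fun s => ∑ i ∈ s, i = n).card) :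
    genSeries c = sumGen qVar F := by
  rw [qVar, ← map_sumGen, genSeries]
  congr 1
  ext n
  rw [PowerSeries.coeff_mk, coeff_sumGen, h]

theorem genSeries_coeff_natCast (c : ℕ → ℕ) (n : ℕ) : (genSeries c).coeff n = c n := by
  rw [genSeries, LaurentSeries.coeff_coe_powerSeries, PowerSeries.coeff_mk]

theorem genSeries_coeff_of_neg (c : ℕ → ℕ) {n : ℤ} (h : n < 0) : (genSeries c).coeff n = 0 := by
  rw [genSeries, PowerSeries.coeff_coe, if_pos h]

theorem eq_of_recurrence {R : Type*} [CommRing R] {q : R} {f g : ℕ → R} (h0 : f 0 = g 0)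
    (h1 : f 1 = g 1)
    (hf : ∀ N, f (N + 2) = (1 + (q + q ^ 2) * q ^ (3 * (N + 1))) * f (N + 1) +
      q ^ (3 * (N + 1)) * (1 - q ^ (3 * (N + 1))) * f N)
    (hg : ∀ N, g (N + 2) = (1 + (q + q ^ 2) * q ^ (3 * (N + 1))) * g (N + 1) +
      q ^ (3 * (N + 1)) * (1 - q ^ (3 * (N + 1))) * g N) (N : ℕ) : f N = g N := by
  induction N using Nat.twoStepInduction with
  | zero => exact h0
  | one => exact h1
  | more N ih ih' => rw [hf, hg, ih, ih']

theorem lhs_eq_genSeries (N : ℕ) : lhs qVar N = genSeries (gapCountLE (3 * N - 1)) := by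
  rw [genSeries_eq_sumGen (gapCountLE_eq _)]
  refine eq_of_recurrence (q := qVar) (f := fun N : ℕ => lhs qVar N)
    (g := fun N => sumGen qVar (gapSets (3 * N - 1))) ?_ ?_
    (lhs_add_two qVar_ne_zero qVar_pow_ne_one) (sumGen_gapSets_add_two _) N
  · exact (lhs_zero qVar_ne_zero qVar_pow_ne_one).trans (sumGen_gapSets_zero _).symm
  · exact (lhs_one qVar_ne_zero qVar_pow_ne_one).trans (sumGen_gapSets_two _).symm

theorem rhs_eq_genSeries (N : ℕ) : rhs qVar N = genSeries (gapCountLE (3 * N - 1)) := by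
  rw [genSeries_eq_sumGen (gapCountLE_eq _)]
  refine eq_of_recurrence (q := qVar) (f := fun N : ℕ => rhs qVar N)
    (g := fun N => sumGen qVar (gapSets (3 * N - 1))) ?_ ?_
    (rhs_add_two qVar_ne_zero qVar_pow_ne_one) (sumGen_gapSets_add_two _) N
  · exact (rhs_zero qVar_ne_zero qVar_pow_ne_one).trans (sumGen_gapSets_zero _).symm
  · exact (rhs_one qVar_ne_zero qVar_pow_ne_one).trans (sumGen_gapSets_two _).symm

/-- With the power series as the subring in `binomSum_sub_mem`, the error is `X^N` times a power
series and cannot reach the coefficient of index `n < N`. -/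
theorem coeff_rhs {n N : ℕ} (h : n < N) : (rhs qVar N).coeff n = distinctCount n := by
  obtain ⟨_, ⟨s, rfl⟩, hs⟩ := binomSum_sub_mem (HahnSeries.ofPowerSeries ℤ ℚ).range
    (q := qVar) ⟨PowerSeries.X, rfl⟩ (pow_pow_succ_ne_one qVar_pow_ne_one 2) N
  rw [prod_eq_sumGen, sub_eq_iff_eq_add', ← rhs_eq_binomSum qVar_ne_zero qVar_pow_ne_one, qVar,
    ← map_sumGen, ← map_pow, ← map_mul, ← map_add] at hs
  rw [qVar, hs, LaurentSeries.coeff_coe_powerSeries, map_add, coeff_sumGen,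
    distinctCount_eq (N := N) (by omega), PowerSeries.coeff_X_pow_mul', if_neg (by omega), add_zero]

theorem distinctCount_eq_gapCount (n : ℕ) : distinctCount n = gapCount n := by
  have h := coeff_rhs (Nat.lt_succ_self n)
  rw [rhs_eq_genSeries, genSeries_coeff_natCast, gapCountLE_of_le (by omega)] at h
  exact_mod_cast h.symm

end Main

end SchurIdentity

theorem corollary6 :
    -- the left-hand side is the generating function of the gap partitions with parts `≤ 3N - 1`
    (∀ N : ℕ, 1 ≤ N →
      SchurIdentity.lhs SchurIdentity.qVar (N : ℤ) =
        SchurIdentity.genSeries (SchurIdentity.gapCountLE (3 * N - 1))) ∧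
    -- so is the right-hand side of the polynomial identity
    (∀ N : ℕ, 1 ≤ N →
      SchurIdentity.rhs SchurIdentity.qVar (N : ℤ) =
        SchurIdentity.genSeries (SchurIdentity.gapCountLE (3 * N - 1))) ∧
    -- limits of both sides, coefficient by coefficient, as `N → ∞`
    (∀ n : ℤ, ∀ᶠ N : ℕ in Filter.atTop,
      (SchurIdentity.lhs SchurIdentity.qVar (N : ℤ)).coeff n =
        (SchurIdentity.genSeries SchurIdentity.gapCount).coeff n) ∧
    (∀ n : ℤ, ∀ᶠ N : ℕ in Filter.atTop,
      (SchurIdentity.rhs SchurIdentity.qVar (N : ℤ)).coeff n =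
        (SchurIdentity.genSeries SchurIdentity.distinctCount).coeff n) ∧
    -- Schur's theorem
    (∀ n : ℕ, SchurIdentity.distinctCount n = SchurIdentity.gapCount n) := by
  open SchurIdentity in
  refine ⟨fun N _ => lhs_eq_genSeries N, fun N _ => rhs_eq_genSeries N, fun n => ?_, fun n => ?_,
    distinctCount_eq_gapCount⟩
  · filter_upwards [Filter.eventually_gt_atTop n.toNat] with N hN
    rw [lhs_eq_genSeries]
    rcases lt_or_ge n 0 with h | h
    · rw [genSeries_coeff_of_neg _ h, genSeries_coeff_of_neg _ h]
    · lift n to ℕ using h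
      rw [Int.toNat_natCast] at hN
      rw [genSeries_coeff_natCast, genSeries_coeff_natCast, gapCountLE_of_le (by omega)]
  · filter_upwards [Filter.eventually_gt_atTop n.toNat] with N hN
    rcases lt_or_ge n 0 with h | h
    · rw [rhs_eq_genSeries, genSeries_coeff_of_neg _ h, genSeries_coeff_of_neg _ h]
    · lift n to ℕ using h
      rw [Int.toNat_natCast] at hN
      rw [coeff_rhs hN, genSeries_coeff_natCast]
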